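/- Let $U\subseteq\mathbb R^d$ be open, let $\mathbf a:\mathbb R^d\to\mathbb R^d$ be of class $C^6$ on $U$, and let $\mathbf q_0\in U$, $\mathbf v_0\in\mathbb R^d$. Consider $\dot{\mathbf q}=\mathbf v$, $\dot{\mathbf v}=\mathbf a(\mathbf q)$ with initial value $(\mathbf q_0,\mathbf v_0)$. One velocity-Verlet step $\mathcal T_2(h)$ is $$\mathbf v_1=\mathbf v_0+\tfrac h2\mathbf a(\mathbf q_0),\qquad \mathbf q_1=\mathbf q_0+h\mathbf v_1,\qquad \mathbf v_2=\mathbf v_1+\tfrac h2\mathbf a(\mathbf q_1),$$ with result $(\mathbf q_1,\mathbf v_2)$. Let $\mathbf q_{i/k}$ be the position reached from $(\mathbf q_0,\mathbf v_0)$ after $i$ steps of $\mathcal T_2(h/k)$, and put $\mathbf a_{i/k}=\mathbf a(\mathbf q_{i/k})$, $\mathbf a_0=\mathbf a(\mathbf q_0)$. A one-step method $\Phi_h$ has order $p$ at $(\mathbf q_0,\mathbf v_0)$ if $\Phi_h(\mathbf q_0,\mathbf v_0)-(\mathbf q(h),\mathbf v(h))=O(h^{p+1})$ as $h\to0$, for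 every solution $(\mathbf q,\mathbf v)$ of the initial value problem near time $0$. All $O(\cdot)$ are as $h\to 0$. Then the following hold. (1) For all $h$, $$\mathbf q_{1/1}=\mathbf q_0+h\mathbf v_0+\tfrac{h^2}{2}\mathbf a_0,\quad \mathbf q_{1/2}=\mathbf q_0+\tfrac h2\mathbf v_0+\tfrac{h^2}{8}\mathbf a_0,\quad \mathbf q_{2/2}=\mathbf q_0+h\mathbf v_0+\tfrac{h^2}{4}(\mathbf a_0+\mathbf a_{1/2}),$$ $$\mathbf q_{1/3}=\mathbf q_0+\tfrac h3\mathbf v_0+\tfrac{h^2}{18}\mathbf a_0,\quad \mathbf q_{2/3}=\mathbf q_0+\tfrac{2}{3}h\mathbf v_0+\tfrac{h^2}{9}(\mathbf a_0+\mathbf a_{1/3}),\quad \mathbf q_{3/3}=\mathbf q_0+h\mathbf v_0+\tfrac{h^2}{18}(3\mathbf a_0+4\mathbf a_{1/3}+2\mathbf a_{2/3}).$$ (2) The extrapolation $\tfrac1{24}\mathcal T_2(h)-\tfrac{16}{15}\mathcal T_2^2(h/2)+\tfrac{81}{40}\mathcal T_2^3(h/3)$ applied to $(\mathbf q_0,\mathbf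 v_0)$ gives, for all $h$, $$\mathbf q=\mathbf q_0+h\mathbf v_0+\tfrac{h^2}{120}(11\mathbf a_0+54\mathbf a_{1/3}-32\mathbf a_{1/2}+27\mathbf a_{2/3}),$$ $$\mathbf v=\mathbf v_0+\tfrac h{240}(22\mathbf a_0+162\mathbf a_{1/3}-128\mathbf a_{1/2}+162\mathbf a_{2/3}+81\mathbf a_{3/3}-64\mathbf a_{2/2}+5\mathbf a_{1/1}),$$ and this method has order six at $(\mathbf q_0,\mathbf v_0)$. (3) Let $\delta\mathbf q_2=\mathbf q_{2/2}-\mathbf q_{1/1}$, $\delta\mathbf q_3=\mathbf q_{3/3}-\mathbf q_{1/1}$ and $\tilde{\mathbf q}_1=\mathbf q_{1/1}+\tfrac1{22}(81\,\delta\mathbf q_3-64\,\delta\mathbf q_2)$. Then $\delta\mathbf q_2=\tfrac{h^2}{4}(\mathbf a_{1/2}-\mathbf a_0)=O(h^3)$, $\delta\mathbf q_3=\tfrac{h^2}{9}(2\mathbf a_{1/3}+\mathbf a_{2/3}-3\mathbf a_0)=O(h^3)$, $$\tilde{\mathbf q}_1=\mathbf q_0+h\mathbf v_0+\tfrac{h^2}{22}(18\mathbf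 a_{1/3}-16\mathbf a_{1/2}+9\mathbf a_{2/3}),$$ and the three final-step forces merge into one: $$81\mathbf a_{3/3}-64\mathbf a_{2/2}+5\mathbf a_{1/1}=22\,\mathbf a(\tilde{\mathbf q}_1)+O(h^6).$$ (4) The method $$\mathbf q=\mathbf q_0+h\mathbf v_0+\tfrac{h^2}{120}(11\mathbf a_0+54\mathbf a_{1/3}-32\mathbf a_{1/2}+27\mathbf a_{2/3}),$$ $$\mathbf v=\mathbf v_0+\tfrac h{240}(22\mathbf a_0+162\mathbf a_{1/3}-128\mathbf a_{1/2}+162\mathbf a_{2/3}+22\,\mathbf a(\tilde{\mathbf q}_1))$$ is computed, for all $h$, with exactly five evaluations of $\mathbf a$ (at $\mathbf q_0,\mathbf q_{1/3},\mathbf q_{1/2},\mathbf q_{2/3},\tilde{\mathbf q}_1$, each point being computed from the earlier forces); it is an explicit five-stage Runge–Kutta–Nyström method; and it has order six at $(\mathbf q_0,\mathbf v_0)$. -/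

import Mathlib

open Filter Topology Asymptotics

noncomputable section

namespace RKN

variable {E : Type*} [NormedAddCommGroup E] [NormedSpace ℝ E]

/-- `(q, v)` is, near time `0`, a solution of `q' = v`, `v' = a(q)` with initial value `z`. -/
structure IsMotion (a : E → E) (z : E × E) (q v : ℝ → E) : Prop where
  init_q : q 0 = z.1
  init_v : v 0 = z.2
  deriv_q : ∀ᶠ t in 𝓝 (0 : ℝ), HasDerivAt q (v t) t
  deriv_v : ∀ᶠ t in 𝓝 (0 : ℝ), HasDerivAt v (a (q t)) t

/-- The one-step method `Φ h` (step size `h`) for `q' = v`, `v' = a(q)` has order `p` at the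
phase space point `z`: one step from `z` has error `O(h^(p+1))` in position and velocity. -/
def HasOrderAt (a : E → E) (Φ : ℝ → E × E → E × E) (p : ℕ) (z : E × E) : Prop :=
  ∀ q v : ℝ → E, IsMotion a z q v →
    (fun h : ℝ => Φ h z - (q h, v h)) =O[𝓝 0] fun h : ℝ => h ^ (p + 1)

/-- One step of size `h` of the velocity form of the Verlet algorithm. -/
def velocityVerlet (a : E → E) (h : ℝ) (z : E × E) : E × E :=
  let v₁ := z.2 + (h / 2) • a z.1
  let q₁ := z.1 + h • v₁
  let v₂ := v₁ + (h / 2) • a q₁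
  (q₁, v₂)

/-- The `{1, 2, 3}` extrapolation of velocity Verlet. -/
def extrapolation123 (a : E → E) (h : ℝ) (z : E × E) : E × E :=
  (1 / 24 : ℝ) • velocityVerlet a h z
    - (16 / 15 : ℝ) • (velocityVerlet a (h / 2))^[2] z
    + (81 / 40 : ℝ) • (velocityVerlet a (h / 3))^[3] z

/-- `q_{i/k}`: the position reached after `i` velocity Verlet steps of size `h / k`. -/
def point (a : E → E) (z : E × E) (i k : ℕ) (h : ℝ) : E :=
  ((velocityVerlet a (h / k))^[i] z).1

/-- `a_{i/k} = a(q_{i/k})`. -/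
def acc (a : E → E) (z : E × E) (i k : ℕ) (h : ℝ) : E :=
  a (point a z i k h)

/-- `δq₂ = q_{2/2} - q_{1/1}`. -/
def delta₂ (a : E → E) (z : E × E) (h : ℝ) : E :=
  point a z 2 2 h - point a z 1 1 h

/-- `δq₃ = q_{3/3} - q_{1/1}`. -/
def delta₃ (a : E → E) (z : E × E) (h : ℝ) : E :=
  point a z 3 3 h - point a z 1 1 h

/-- `q̃₁ = q_{1/1} + (81 δq₃ - 64 δq₂) / 22`. -/
def mergedPoint (a : E → E) (z : E × E) (h : ℝ) : E :=
  point a z 1 1 h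
    + (1 / 22 : ℝ) • ((81 : ℝ) • delta₃ a z h - (64 : ℝ) • delta₂ a z h)

/-- A computation that has access to the force (acceleration) only by querying it at points:
it either returns a result, or queries the force at `x` and continues with the answer. -/
inductive ForceProgram (E R : Type*) where
  | done (r : R) : ForceProgram E R
  | force (x : E) (next : E → ForceProgram E R) : ForceProgram E R

namespace ForceProgram

/-- The result of the computation when queries are answered by `a`. -/
def run {F R : Type*} (a : F → F) : ForceProgram F R → R
  | done r => r
  | force x next => (next (a x)).run a

/-- The number of force evaluations made when queries are answered by `a`. -/
def evals {F R : Type*} (a : F → F) : ForceProgram F R → ℕ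
  | done _ => 0
  | force x next => (next (a x)).evals a + 1

end ForceProgram

open ForceProgram in
/-- The integrator with merged final force, as a sequence of force evaluations. -/
def integrator (h : ℝ) (z : E × E) : ForceProgram E (E × E) :=
  let q₀ := z.1
  let v₀ := z.2
  force q₀ fun a₀ =>
  force (q₀ + (h / 3) • v₀ + (h ^ 2 / 18) • a₀) fun a₁₃ =>
  force (q₀ + (h / 2) • v₀ + (h ^ 2 / 8) • a₀) fun a₁₂ =>
  force (q₀ + (2 / 3 * h) • v₀ + (h ^ 2 / 9) • (a₀ + a₁₃)) fun a₂₃ =>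
  force (q₀ + h • v₀
      + (h ^ 2 / 22) • ((18 : ℝ) • a₁₃ - (16 : ℝ) • a₁₂ + (9 : ℝ) • a₂₃)) fun a₁ =>
  done
    (q₀ + h • v₀ + (h ^ 2 / 120) •
        ((11 : ℝ) • a₀ + (54 : ℝ) • a₁₃ - (32 : ℝ) • a₁₂ + (27 : ℝ) • a₂₃),
      v₀ + (h / 240) •
        ((22 : ℝ) • a₀ + (162 : ℝ) • a₁₃ - (128 : ℝ) • a₁₂ + (162 : ℝ) • a₂₃
          + (22 : ℝ) • a₁))

/-- The one-step method that the integrator computes for the acceleration `a`. -/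
def integratorStep (a : E → E) (h : ℝ) (z : E × E) : E × E :=
  (integrator h z).run a

/-- The coefficients of an explicit Runge-Kutta-Nyström method with `s` stages. -/
structure Tableau (s : ℕ) where
  c : Fin s → ℝ
  A : Matrix (Fin s) (Fin s) ℝ
  bq : Fin s → ℝ
  bv : Fin s → ℝ
  explicit : ∀ i j, i ≤ j → A i j = 0

namespace Tableau

/-- The vectors `Q` are the stages of the Runge-Kutta-Nyström method:
`Qᵢ = q₀ + cᵢ h v₀ + h² ∑ⱼ Aᵢⱼ a(Qⱼ)`; as `A` is strictly lower triangular, these equations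
determine `Q` recursively. -/
def IsStages {s : ℕ} (T : Tableau s) (a : E → E) (h : ℝ) (z : E × E) (Q : Fin s → E) : Prop :=
  ∀ i, Q i = z.1 + (T.c i * h) • z.2 + h ^ 2 • ∑ j, T.A i j • a (Q j)

/-- The result of a step with stages `Q`. -/
def update {s : ℕ} (T : Tableau s) (a : E → E) (h : ℝ) (z : E × E) (Q : Fin s → E) : E × E :=
  (z.1 + h • z.2 + h ^ 2 • ∑ i, T.bq i • a (Q i), z.2 + h • ∑ i, T.bv i • a (Q i))

/-- For every force and every starting point, the explicit method `T` has exactly one family of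
stages, and its step is the step of the one-step method `Φ`. -/
def Realizes {s : ℕ} (T : Tableau s) (Φ : (E → E) → ℝ → E × E → E × E) : Prop :=
  ∀ (a : E → E) (h : ℝ) (z : E × E),
    (∃! Q : Fin s → E, T.IsStages a h z Q) ∧
      ∀ Q : Fin s → E, T.IsStages a h z Q → T.update a h z Q = Φ a h z

end Tableau

/-- The five-stage Runge-Kutta-Nyström coefficients of the integrator; the stages are at times
`0, 1/3, 1/2, 2/3, 1` (in units of the step size). -/
def integratorTableau : Tableau 5 where
  c := ![0, 1 / 3, 1 / 2, 2 / 3, 1]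
  A := !![0, 0, 0, 0, 0;
          1 / 18, 0, 0, 0, 0;
          1 / 8, 0, 0, 0, 0;
          1 / 9, 1 / 9, 0, 0, 0;
          0, 18 / 22, -16 / 22, 9 / 22, 0]
  bq := ![11 / 120, 54 / 120, -32 / 120, 27 / 120, 0]
  bv := ![22 / 240, 162 / 240, -128 / 240, 162 / 240, 22 / 240]
  explicit := by
    intro i j hij
    fin_cases i <;> fin_cases j <;> simp_all

end RKN

end

/-! Order six is checked along the exact solution, without rooted trees. Let `f k` and `J k` be the
Taylor coefficients of `a ∘ q` and of `fderiv ℝ a` along `q`. Every stage lies within `O(h³)` of `q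
(c h)`, so linearizing `a` there costs only `O(h⁶)`: the stage force is `a (q (c h))` plus the
Jacobian applied to the stage error (`IsExpansion.force_stage`). The step is then linear in the
vectors `f k`, `J i (f k)`, `J 0 (J 0 (f 1))`, and order six becomes a set of rational identities
between coefficients, verified by `module` in `hasOrderAt_integratorStep`.

The three final forces merge by the same quadratic bound (`isBigO_sub_sub_fderiv`), now based at
`q_{1/1}`: since `81 - 64 + 5 = 22`, and `q̃₁` is the correspondingly weighted mean of the three
points, constant and linear terms cancel. The extrapolation therefore has the integrator's position
and a velocity differing by `h · O(h⁶)`, so it inherits order six. -/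

namespace RKN

/-! ### Taylor expansion and asymptotic bounds at `0` -/

section Calculus

variable {E F : Type*} [NormedAddCommGroup E] [NormedSpace ℝ E]
  [NormedAddCommGroup F] [NormedSpace ℝ F]

/-- Integration of an asymptotic bound at `0`. -/
theorem isBigO_pow_succ_of_hasDerivAt {g g' : ℝ → E} {n : ℕ}
    (hd : ∀ᶠ t in 𝓝 (0 : ℝ), HasDerivAt g (g' t) t) (h0 : g 0 = 0)
    (h : g' =O[𝓝 0] fun t : ℝ => t ^ n) : g =O[𝓝 0] fun t : ℝ => t ^ (n + 1) := by
  obtain ⟨C, hC0, hC⟩ := h.exists_nonneg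
  obtain ⟨ε, hε, hb⟩ := Metric.eventually_nhds_iff.1 (hd.and hC.bound)
  refine IsBigO.of_bound C (Metric.eventually_nhds_iff.2 ⟨ε, hε, fun t ht => ?_⟩)
  have hmem : ∀ s ∈ Metric.closedBall (0 : ℝ) ‖t‖, dist s 0 < ε := fun s hs =>
    lt_of_le_of_lt (Metric.mem_closedBall.1 hs) (by simpa using ht)
  have key := (convex_closedBall (0 : ℝ) ‖t‖).norm_image_sub_le_of_norm_hasDerivWithin_le
    (f := g) (f' := g') (C := C * ‖t‖ ^ n) (x := 0) (y := t)
    (fun s hs => (hb (hmem s hs)).1.hasDerivWithinAt)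
    (fun s hs => (hb (hmem s hs)).2.trans (by
      rw [norm_pow]
      gcongr
      simpa using hs))
    (by simp) (by simp)
  rw [h0, sub_zero, sub_zero] at key
  rw [norm_pow, pow_succ, ← mul_assoc]
  exact key

/-- If the derivative has an expansion in powers of `t`, it can be integrated termwise. -/
theorem isBigO_sub_sum_of_hasDerivAt {g g' : ℝ → E} {n : ℕ} {c : ℕ → E}
    (hd : ∀ᶠ t in 𝓝 (0 : ℝ), HasDerivAt g (g' t) t)
    (h : (fun t => g' t - ∑ k ∈ Finset.range n, t ^ k • c k) =O[𝓝 0] fun t : ℝ => t ^ n) :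
    (fun t => g t - (g 0 + ∑ k ∈ Finset.range n, t ^ (k + 1) • ((k + 1 : ℝ)⁻¹ • c k)))
      =O[𝓝 0] fun t : ℝ => t ^ (n + 1) := by
  refine isBigO_pow_succ_of_hasDerivAt
    (g' := fun t => g' t - ∑ k ∈ Finset.range n, t ^ k • c k) ?_ (by simp) h
  filter_upwards [hd] with t ht
  refine ht.sub (HasDerivAt.const_add _ (HasDerivAt.fun_sum fun k _ => ?_))
  have := (hasDerivAt_pow (k + 1) t).smul_const ((k + 1 : ℝ)⁻¹ • c k)
  convert this using 1
  have hk : (k + 1 : ℝ) ≠ 0 := by positivity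
  rw [smul_smul]
  congr 1
  rw [Nat.add_sub_cancel]
  push_cast
  field_simp

/-- Taylor's theorem at `0` for a vector-valued function of a real variable. -/
theorem exists_taylor_isBigO (n : ℕ) : ∀ {f : ℝ → E}, ContDiffAt ℝ n f 0 →
    ∃ c : ℕ → E, (fun t => f t - ∑ k ∈ Finset.range n, t ^ k • c k)
      =O[𝓝 0] fun t : ℝ => t ^ n := by
  induction n with
  | zero =>
    intro f hf
    refine ⟨0, ?_⟩
    simpa using hf.continuousAt.norm.isBoundedUnder_le.isBigO_one ℝ
  | succ n ih =>
    intro f hf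
    have hd : ∀ᶠ t in 𝓝 (0 : ℝ), HasDerivAt f (deriv f t) t := by
      filter_upwards [hf.eventually (by simp)] with t ht
      exact (ht.differentiableAt (by simp)).hasDerivAt
    have hf' : ContDiffAt ℝ n (deriv f) 0 := by
      have h1 : ContDiffAt ℝ n (fderiv ℝ f) 0 := hf.fderiv_right (by simp)
      exact h1.clm_apply contDiffAt_const
    obtain ⟨c, hc⟩ := ih hf'
    -- The value at `0`, followed by the termwise integrals of the expansion of `deriv f`.
    refine ⟨fun k => k.casesOn (f 0) fun k => (k + 1 : ℝ)⁻¹ • c k, ?_⟩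
    refine (isBigO_sub_sum_of_hasDerivAt hd hc).congr_left fun t => ?_
    rw [Finset.sum_range_succ']
    simp [add_comm]

theorem contDiffAt_succ_of_hasDerivAt {g g' : ℝ → E} {n : ℕ} {x : ℝ}
    (hd : ∀ᶠ t in 𝓝 x, HasDerivAt g (g' t) t) (h : ContDiffAt ℝ n g' x) :
    ContDiffAt ℝ (n + 1) g x := by
  rw [contDiffAt_succ_iff_hasFDerivAt]
  exact ⟨fun t => ContinuousLinearMap.toSpanSingleton ℝ (g' t),
    ⟨_, hd, fun t ht => ht.hasFDerivAt⟩,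
    (ContinuousLinearMap.toSpanSingletonLIE ℝ E).contDiff.contDiffAt.comp x h⟩

/-- The remainder of the linearization of a `C^2` function is quadratic, uniformly with respect
to the base point. -/
theorem isBigO_sub_sub_fderiv {α : Type*} {l : Filter α} {a : E → F} {x : E}
    (ha : ContDiffAt ℝ 2 a x) {P Q : α → E} (hP : Tendsto P l (𝓝 x)) (hQ : Tendsto Q l (𝓝 x)) :
    (fun s => a (Q s) - a (P s) - fderiv ℝ a (P s) (Q s - P s))
      =O[l] fun s => ‖Q s - P s‖ ^ 2 := by
  have h1 : ContDiffAt ℝ 1 (fderiv ℝ a) x := ha.fderiv_right (by norm_num [one_add_one_eq_two])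
  obtain ⟨K, u, hu, hK⟩ := h1.exists_lipschitzOnWith
  have hd : ∀ᶠ y in 𝓝 x, DifferentiableAt ℝ a y := by
    filter_upwards [ha.eventually (by simp)] with y hy
    exact hy.differentiableAt (by simp)
  obtain ⟨ε, hε, hb⟩ := Metric.eventually_nhds_iff_ball.1 (hd.and hu)
  refine IsBigO.of_bound K ?_
  filter_upwards [hP (Metric.ball_mem_nhds x hε), hQ (Metric.ball_mem_nhds x hε)] with s hPs hQs
  have hsub : segment ℝ (P s) (Q s) ⊆ Metric.ball x ε :=
    (convex_ball x ε).segment_subset hPs hQs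
  -- The derivative is `K`-Lipschitz near `x`, so on the segment it differs from its value at `P s`
  -- by at most `K * ‖Q s - P s‖`; the mean value inequality supplies the second factor.
  have key := (convex_segment (P s) (Q s)).norm_image_sub_le_of_norm_fderiv_le' (𝕜 := ℝ)
    (f := a) (φ := fderiv ℝ a (P s)) (C := K * ‖Q s - P s‖)
    (fun y hy => (hb y (hsub hy)).1)
    (fun y hy => by
      refine (hK.norm_sub_le (hb y (hsub hy)).2 (hb _ hPs).2).trans ?_
      gcongr
      exact norm_sub_le_of_mem_segment hy)
    (left_mem_segment ..) (right_mem_segment ..)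
  rw [norm_pow, norm_norm, sq, ← mul_assoc]
  exact key

theorem isBigO_pow_of_le {m n : ℕ} (h : m ≤ n) :
    (fun t : ℝ => t ^ n) =O[𝓝 0] fun t : ℝ => t ^ m := by
  obtain ⟨k, rfl⟩ := Nat.exists_eq_add_of_le h
  have h1 : (fun t : ℝ => t ^ k) =O[𝓝 0] fun _ : ℝ => (1 : ℝ) :=
    ((continuous_pow k).tendsto 0).isBigO_one ℝ
  simpa [pow_add] using (isBigO_refl (fun t : ℝ => t ^ m) (𝓝 0)).mul h1

theorem isBigO_pow_of_continuousAt {f : ℝ → E} (hf : ContinuousAt f 0) (n : ℕ) :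
    (fun t => t ^ n • f t) =O[𝓝 0] fun t : ℝ => t ^ n := by
  simpa using (isBigO_refl (fun t : ℝ => t ^ n) (𝓝 0)).smul (hf.isBigO_one ℝ)

theorem isBigO_comp_const_mul {E : Type*} [NormedAddCommGroup E] {f : ℝ → E} {n : ℕ}
    (hf : f =O[𝓝 0] fun t : ℝ => t ^ n) (c : ℝ) :
    (fun t => f (c * t)) =O[𝓝 0] fun t : ℝ => t ^ n := by
  have ht : Tendsto (fun t : ℝ => c * t) (𝓝 0) (𝓝 0) := by
    simpa using (continuous_const_mul c).tendsto (0 : ℝ)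
  refine (hf.comp_tendsto ht).trans ?_
  simpa [Function.comp_def, mul_pow] using
    (isBigO_refl (fun t : ℝ => t ^ n) (𝓝 0)).const_mul_left (c ^ n)

end Calculus

/-! ### Regularity of solutions -/

section Motion

variable {E : Type*} [NormedAddCommGroup E] [NormedSpace ℝ E]

/-- Bootstrapping: `q' = v` and `v' = a ∘ q`, so each derivative known for both `q` and `v` gives
one more for both; the induction must carry the pair. -/
theorem IsMotion.contDiffAt {a : E → E} {z : E × E} {q v : ℝ → E} (hm : IsMotion a z q v)
    {N : ℕ} (ha : ContDiffAt ℝ N a z.1) : ContDiffAt ℝ N q 0 := by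
  have key : ∀ n : ℕ, n ≤ N → ContDiffAt ℝ n q 0 ∧ ContDiffAt ℝ n v 0 := by
    intro n
    induction n with
    | zero =>
      intro _
      exact ⟨contDiffAt_zero.2 ⟨_, hm.deriv_q, fun t ht =>
          (HasDerivAt.continuousAt ht).continuousWithinAt⟩,
        contDiffAt_zero.2 ⟨_, hm.deriv_v, fun t ht =>
          (HasDerivAt.continuousAt ht).continuousWithinAt⟩⟩
    | succ n ih =>
      intro hn
      obtain ⟨hq, hv⟩ := ih (by omega)
      have han : ContDiffAt ℝ n a (q 0) := by
        rw [hm.init_q]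
        exact ha.of_le (by exact_mod_cast (by omega : n ≤ N))
      push_cast
      exact ⟨contDiffAt_succ_of_hasDerivAt hm.deriv_q hv,
        contDiffAt_succ_of_hasDerivAt hm.deriv_v (han.comp 0 hq)⟩
  exact (key N le_rfl).1

end Motion

/-! ### Order six of the merged integrator -/

section Order

variable {E : Type*} [NormedAddCommGroup E] [NormedSpace ℝ E]

/-- Expansions along the solution `q` starting at `z`: `f` and `J` are the Taylor coefficients of
`a ∘ q` and of the derivative of `a` along `q`, and those of `q` and `v` are the corresponding
integrals. -/
structure IsExpansion (a : E → E) (z : E × E) (q v : ℝ → E) (f : ℕ → E) (J : ℕ → E →L[ℝ] E) :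
    Prop where
  force : (fun t => a (q t) - (f 0 + t • f 1 + t ^ 2 • f 2 + t ^ 3 • f 3 + t ^ 4 • f 4
    + t ^ 5 • f 5)) =O[𝓝 0] fun t : ℝ => t ^ 6
  jacobian : (fun t => fderiv ℝ a (q t) - (J 0 + t • J 1 + t ^ 2 • J 2))
    =O[𝓝 0] fun t : ℝ => t ^ 3
  velocity : (fun t => v t - (z.2 + t • f 0 + (t ^ 2 / 2) • f 1 + (t ^ 3 / 3) • f 2
    + (t ^ 4 / 4) • f 3 + (t ^ 5 / 5) • f 4 + (t ^ 6 / 6) • f 5)) =O[𝓝 0] fun t : ℝ => t ^ 7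
  position : (fun t => q t - (z.1 + t • z.2 + (t ^ 2 / 2) • f 0 + (t ^ 3 / 6) • f 1
    + (t ^ 4 / 12) • f 2 + (t ^ 5 / 20) • f 3 + (t ^ 6 / 30) • f 4))
    =O[𝓝 0] fun t : ℝ => t ^ 7

theorem IsMotion.exists_isExpansion {a : E → E} {z : E × E} {q v : ℝ → E}
    (hm : IsMotion a z q v) (ha : ContDiffAt ℝ 6 a z.1) : ∃ f J, IsExpansion a z q v f J := by
  have hq : ContDiffAt ℝ 6 q 0 := hm.contDiffAt (N := 6) ha
  rw [← hm.init_q] at ha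
  obtain ⟨f, hf⟩ := exists_taylor_isBigO (f := fun t => a (q t)) 6 (ha.comp 0 hq)
  have hJ : ContDiffAt ℝ 3 (fun t => fderiv ℝ a (q t)) 0 :=
    (ha.fderiv_right (m := 3) (by norm_num)).comp (0 : ℝ) (hq.of_le (by norm_num))
  obtain ⟨J, hJ⟩ := exists_taylor_isBigO 3 hJ
  have hv := isBigO_sub_sum_of_hasDerivAt hm.deriv_v hf
  rw [hm.init_v] at hv
  have hq' := isBigO_sub_sum_of_hasDerivAt (n := 7)
    (c := fun k => k.casesOn z.2 fun k => (k + 1 : ℝ)⁻¹ • f k) hm.deriv_q (by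
      refine hv.congr_left fun t => ?_
      rw [Finset.sum_range_succ' _ 6]
      simp [add_comm])
  rw [hm.init_q] at hq'
  -- Integrating the velocity expansion yields a term `t ^ 7 / 42 • f 5`, which is absorbed into the
  -- `O(t ^ 7)` error.
  have hq7 := (hq'.trans (isBigO_pow_of_le (show 7 ≤ 8 by norm_num))).add
    (isBigO_pow_of_continuousAt (f := fun _ : ℝ => (42 : ℝ)⁻¹ • f 5) continuousAt_const 7)
  refine ⟨f, J, ?_, ?_, ?_, ?_⟩
  · refine hf.congr_left fun t => ?_
    simp [Finset.sum_range_succ]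
  · refine hJ.congr_left fun t => ?_
    simp [Finset.sum_range_succ]
  · refine hv.congr_left fun t => ?_
    simp only [Finset.sum_range_succ, Finset.sum_range_zero]
    push_cast
    module
  · refine hq7.congr_left fun t => ?_
    rw [Finset.sum_range_succ']
    simp only [Finset.sum_range_succ, Finset.sum_range_zero]
    push_cast
    module

theorem tendsto_of_isBigO_pow {E : Type*} [NormedAddCommGroup E] {g : ℝ → E} {x : E} {n : ℕ} (hn : n ≠ 0)
    (h : (fun t => g t - x) =O[𝓝 0] fun t : ℝ => t ^ n) : Tendsto g (𝓝 0) (𝓝 x) := by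
  rw [tendsto_iff_norm_sub_tendsto_zero]
  refine (h.trans_tendsto ?_).norm.trans (by simp)
  simpa [hn] using (continuous_pow n).tendsto (0 : ℝ)

theorem isBigO_clm_apply {A : ℝ → E →L[ℝ] E} {g : ℝ → E} {m n : ℕ}
    (hA : A =O[𝓝 0] fun t : ℝ => t ^ m) (hg : g =O[𝓝 0] fun t : ℝ => t ^ n) :
    (fun t => A t (g t)) =O[𝓝 0] fun t : ℝ => t ^ (m + n) := by
  have h1 : (fun t => A t (g t)) =O[𝓝 0] fun t => ‖A t‖ * ‖g t‖ :=
    IsBigO.of_bound 1 (Eventually.of_forall fun t => by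
      simpa using (A t).le_opNorm (g t))
  refine h1.trans ?_
  simpa only [pow_add] using hA.norm_left.mul hg.norm_left

/-- The force at an approximation of the solution at time `c h`, if the error of the approximation
is `h³ e₃ + h⁴ e₄ + h⁵ e₅ + O(h⁶)`. -/
theorem IsExpansion.force_stage {a : E → E} {z : E × E} {q v : ℝ → E} {f : ℕ → E}
    {J : ℕ → E →L[ℝ] E} (hx : IsExpansion a z q v f J) (ha : ContDiffAt ℝ 2 a z.1)
    (hq : Tendsto q (𝓝 0) (𝓝 z.1)) (c : ℝ) (e₃ e₄ e₅ : E) {Q : ℝ → E}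
    (hQ : (fun h => Q h - (z.1 + (c * h) • z.2 + ((c * h) ^ 2 / 2) • f 0
      + h ^ 3 • ((c ^ 3 / 6) • f 1 + e₃) + h ^ 4 • ((c ^ 4 / 12) • f 2 + e₄)
      + h ^ 5 • ((c ^ 5 / 20) • f 3 + e₅))) =O[𝓝 0] fun h : ℝ => h ^ 6) :
    (fun h => a (Q h) - (f 0 + (c * h) • f 1 + (c * h) ^ 2 • f 2
      + h ^ 3 • (c ^ 3 • f 3 + J 0 e₃)
      + h ^ 4 • (c ^ 4 • f 4 + J 0 e₄ + c • J 1 e₃)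
      + h ^ 5 • (c ^ 5 • f 5 + J 0 e₅ + c • J 1 e₄ + c ^ 2 • J 2 e₃)))
      =O[𝓝 0] fun h : ℝ => h ^ 6 := by
  have hc : Tendsto (fun t : ℝ => c * t) (𝓝 0) (𝓝 0) := by
    simpa using (continuous_const_mul c).tendsto (0 : ℝ)
  have hqc : Tendsto (fun h => q (c * h)) (𝓝 0) (𝓝 z.1) := hq.comp hc
  have hD : (fun h => Q h - q (c * h) - (h ^ 3 • e₃ + h ^ 4 • e₄ + h ^ 5 • e₅))
      =O[𝓝 0] fun h : ℝ => h ^ 6 := by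
    have h1 := (isBigO_comp_const_mul hx.position c).trans
      (isBigO_pow_of_le (show 6 ≤ 7 by norm_num))
    have h2 := isBigO_pow_of_continuousAt (f := fun _ : ℝ => (c ^ 6 / 30) • f 4)
      continuousAt_const 6
    refine ((hQ.sub h1).sub h2).congr_left fun h => ?_
    module
  have hD3 : (fun h => Q h - q (c * h)) =O[𝓝 0] fun h : ℝ => h ^ 3 := by
    have h1 := hD.trans (isBigO_pow_of_le (show 3 ≤ 6 by norm_num))
    have h2 := isBigO_pow_of_continuousAt (f := fun h : ℝ => e₃ + h • e₄ + h ^ 2 • e₅)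
      (by fun_prop) 3
    refine (h1.add h2).congr_left fun h => ?_
    module
  have hQt : Tendsto Q (𝓝 0) (𝓝 z.1) := by
    have h0 : Tendsto (fun h => Q h - q (c * h)) (𝓝 0) (𝓝 0) :=
      tendsto_of_isBigO_pow (n := 3) (by norm_num) (by simpa using hD3)
    simpa using h0.add hqc
  have hquad : (fun h => a (Q h) - a (q (c * h)) - fderiv ℝ a (q (c * h)) (Q h - q (c * h)))
      =O[𝓝 0] fun h : ℝ => h ^ 6 := by
    -- The remainder is the square of an `O(h³)` displacement. For the same reason three Jacobian
    -- coefficients suffice: their `O(h³)` tail acts on an `O(h³)` vector.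
    refine (isBigO_sub_sub_fderiv ha hqc hQt).trans ?_
    simpa [← pow_mul] using hD3.norm_left.pow 2
  have hJc := isBigO_clm_apply (isBigO_comp_const_mul hx.jacobian c) hD3
  have hpoly : (fun h : ℝ => J 0 + (c * h) • J 1 + (c * h) ^ 2 • J 2)
      =O[𝓝 0] fun h : ℝ => h ^ 0 := by
    simpa using isBigO_pow_of_continuousAt
      (f := fun h : ℝ => J 0 + (c * h) • J 1 + (c * h) ^ 2 • J 2) (by fun_prop) 0
  have hJD := isBigO_clm_apply hpoly hD
  have hf := isBigO_comp_const_mul hx.force c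
  -- The products of Jacobian and error terms of degree 6 and 7 in `h`.
  have hrest := isBigO_pow_of_continuousAt (f := fun h : ℝ =>
    c • J 1 e₅ + c ^ 2 • J 2 e₄ + h • c ^ 2 • J 2 e₅) (by fun_prop) 6
  refine ((((hquad.add hJc).add (hJD.congr_right fun h => by ring)).add hf).add
    hrest).congr_left fun h => ?_
  simp only [sub_apply, add_apply, smul_apply, map_sub, map_add, map_smul]
  module

/-- Forces enter later stages with a factor `h ^ 2`, so there they are needed only up to `O(h⁴)`,
and `e₄`, `e₅` drop out of the result. -/
theorem IsExpansion.force_stage_low {a : E → E} {z : E × E} {q v : ℝ → E} {f : ℕ → E}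
    {J : ℕ → E →L[ℝ] E} (hx : IsExpansion a z q v f J) (ha : ContDiffAt ℝ 2 a z.1)
    (hq : Tendsto q (𝓝 0) (𝓝 z.1)) (c : ℝ) (e₃ e₄ e₅ : E) {Q : ℝ → E}
    (hQ : (fun h => Q h - (z.1 + (c * h) • z.2 + ((c * h) ^ 2 / 2) • f 0
      + h ^ 3 • ((c ^ 3 / 6) • f 1 + e₃) + h ^ 4 • ((c ^ 4 / 12) • f 2 + e₄)
      + h ^ 5 • ((c ^ 5 / 20) • f 3 + e₅))) =O[𝓝 0] fun h : ℝ => h ^ 6) :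
    (fun h => h ^ 2 • a (Q h) - h ^ 2 • (f 0 + (c * h) • f 1 + (c * h) ^ 2 • f 2
      + h ^ 3 • (c ^ 3 • f 3 + J 0 e₃))) =O[𝓝 0] fun h : ℝ => h ^ 6 := by
  have h1 := (hx.force_stage ha hq c e₃ e₄ e₅ hQ).trans
    (isBigO_pow_of_le (show 4 ≤ 6 by norm_num))
  have h2 := isBigO_pow_of_continuousAt (f := fun h : ℝ =>
    c ^ 4 • f 4 + J 0 e₄ + c • J 1 e₃
      + h • (c ^ 5 • f 5 + J 0 e₅ + c • J 1 e₄ + c ^ 2 • J 2 e₃)) (by fun_prop) 4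
  refine ((isBigO_refl (fun h : ℝ => h ^ 2) (𝓝 0)).smul (h1.add h2)).congr
    (fun h => ?_) fun h => ?_
  · module
  · simp only [smul_eq_mul]
    ring

/-- The asymptotic bound also holds at `t = 0`, where its right-hand side vanishes. -/
theorem IsExpansion.init {a : E → E} {z : E × E} {q v : ℝ → E} {f : ℕ → E}
    {J : ℕ → E →L[ℝ] E} (hx : IsExpansion a z q v f J) (hq : q 0 = z.1) : a z.1 = f 0 := by
  obtain ⟨C, hC⟩ := hx.force.bound
  simpa [hq, sub_eq_zero] using hC.self_of_nhds

theorem hasOrderAt_integratorStep {a : E → E} {z : E × E} (ha : ContDiffAt ℝ 6 a z.1) :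
    HasOrderAt a (integratorStep a) 6 z := by
  intro q v hm
  obtain ⟨f, J, hx⟩ := hm.exists_isExpansion ha
  have ha2 : ContDiffAt ℝ 2 a z.1 := ha.of_le (by norm_num)
  have hq : Tendsto q (𝓝 0) (𝓝 z.1) := by
    rw [← hm.init_q]
    exact hm.deriv_q.self_of_nhds.continuousAt
  have h0 : a z.1 = f 0 := hx.init hm.init_q
  set Q₁ : ℝ → E := fun h => z.1 + (h / 3) • z.2 + (h ^ 2 / 18) • a z.1 with hQ₁
  set Q₂ : ℝ → E := fun h => z.1 + (h / 2) • z.2 + (h ^ 2 / 8) • a z.1 with hQ₂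
  set Q₃ : ℝ → E := fun h => z.1 + (2 / 3 * h) • z.2 + (h ^ 2 / 9) • (a z.1 + a (Q₁ h)) with hQ₃
  set Q₄ : ℝ → E := fun h => z.1 + h • z.2
    + (h ^ 2 / 22) • ((18 : ℝ) • a (Q₁ h) - (16 : ℝ) • a (Q₂ h) + (9 : ℝ) • a (Q₃ h)) with hQ₄
  have hstep : ∀ h, integratorStep a h z =
      (z.1 + h • z.2 + (h ^ 2 / 120) • ((11 : ℝ) • a z.1 + (54 : ℝ) • a (Q₁ h)
          - (32 : ℝ) • a (Q₂ h) + (27 : ℝ) • a (Q₃ h)),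
        z.2 + (h / 240) • ((22 : ℝ) • a z.1 + (162 : ℝ) • a (Q₁ h) - (128 : ℝ) • a (Q₂ h)
          + (162 : ℝ) • a (Q₃ h) + (22 : ℝ) • a (Q₄ h))) := fun h => rfl
  -- This stage is exactly quadratic in `h`, so its errors are minus the cubic to quintic Taylor
  -- terms of `q (h / 3)`, for instance `1 / 162 = (1 / 3) ^ 3 / 6`. The difference is identically
  -- zero.
  have e₁ := (isBigO_zero (fun h : ℝ => h ^ 6) (𝓝 0)).congr_left
    (f₂ := fun h => Q₁ h - (z.1 + ((1 / 3) * h) • z.2 + (((1 / 3) * h) ^ 2 / 2) • f 0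
      + h ^ 3 • (((1 / 3 : ℝ) ^ 3 / 6) • f 1 + -(1 / 162 : ℝ) • f 1)
      + h ^ 4 • (((1 / 3 : ℝ) ^ 4 / 12) • f 2 + -(1 / 972 : ℝ) • f 2)
      + h ^ 5 • (((1 / 3 : ℝ) ^ 5 / 20) • f 3 + -(1 / 4860 : ℝ) • f 3))) fun h => by
    simp only [hQ₁, h0]
    module
  have e₂ := (isBigO_zero (fun h : ℝ => h ^ 6) (𝓝 0)).congr_left
    (f₂ := fun h => Q₂ h - (z.1 + ((1 / 2) * h) • z.2 + (((1 / 2) * h) ^ 2 / 2) • f 0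
      + h ^ 3 • (((1 / 2 : ℝ) ^ 3 / 6) • f 1 + -(1 / 48 : ℝ) • f 1)
      + h ^ 4 • (((1 / 2 : ℝ) ^ 4 / 12) • f 2 + -(1 / 192 : ℝ) • f 2)
      + h ^ 5 • (((1 / 2 : ℝ) ^ 5 / 20) • f 3 + -(1 / 640 : ℝ) • f 3))) fun h => by
    simp only [hQ₂, h0]
    module
  have l₁ := hx.force_stage_low ha2 hq _ _ _ _ e₁
  have l₂ := hx.force_stage_low ha2 hq _ _ _ _ e₂
  have e₃ := (l₁.const_smul_left (1 / 9 : ℝ)).congr_left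
    (f₂ := fun h => Q₃ h - (z.1 + ((2 / 3) * h) • z.2 + (((2 / 3) * h) ^ 2 / 2) • f 0
      + h ^ 3 • (((2 / 3 : ℝ) ^ 3 / 6) • f 1 + -(1 / 81 : ℝ) • f 1)
      + h ^ 4 • (((2 / 3 : ℝ) ^ 4 / 12) • f 2 + -(1 / 243 : ℝ) • f 2)
      + h ^ 5 • (((2 / 3 : ℝ) ^ 5 / 20) • f 3
        + (-(1 / 405 : ℝ) • f 3 - (1 / 1458 : ℝ) • J 0 (f 1))))) fun h => by
    simp only [hQ₃, h0, Pi.smul_apply, map_smul]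
    module
  have l₃ := hx.force_stage_low ha2 hq _ _ _ _ e₃
  -- The errors in `f₂` are what the weighted forces leave after subtracting the Taylor terms of `q
  -- h`: `4 / 22 - 1 / 6 = 1 / 66` at `h ^ 3`.
  have e₄ := (((l₁.const_smul_left (18 / 22 : ℝ)).sub (l₂.const_smul_left (16 / 22 : ℝ))).add
      (l₃.const_smul_left (9 / 22 : ℝ))).congr_left
    (f₂ := fun h => Q₄ h - (z.1 + (1 * h) • z.2 + ((1 * h) ^ 2 / 2) • f 0
      + h ^ 3 • (((1 : ℝ) ^ 3 / 6) • f 1 + (1 / 66 : ℝ) • f 1)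
      + h ^ 4 • (((1 : ℝ) ^ 4 / 12) • f 2 + (1 / 132 : ℝ) • f 2)
      + h ^ 5 • (((1 : ℝ) ^ 5 / 20) • f 3
        + ((7 / 660 : ℝ) • f 3 + (1 / 198 : ℝ) • J 0 (f 1))))) fun h => by
    simp only [hQ₄, Pi.smul_apply, map_smul]
    module
  have s₁ := hx.force_stage ha2 hq _ _ _ _ e₁
  have s₂ := hx.force_stage ha2 hq _ _ _ _ e₂
  have s₃ := hx.force_stage ha2 hq _ _ _ _ e₃
  have s₄ := hx.force_stage ha2 hq _ _ _ _ e₄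
  have hmul : ∀ {g : ℝ → E}, g =O[𝓝 0] (fun h : ℝ => h ^ 6) →
      (fun h => h • g h) =O[𝓝 0] fun h : ℝ => h ^ 7 := fun {g} hg =>
    ((isBigO_refl (fun h : ℝ => h) (𝓝 0)).smul hg).congr_right fun h => by
      simp only [smul_eq_mul]
      ring
  have hmul2 : ∀ {g : ℝ → E}, g =O[𝓝 0] (fun h : ℝ => h ^ 6) →
      (fun h => h ^ 2 • g h) =O[𝓝 0] fun h : ℝ => h ^ 7 := fun {g} hg =>
    (((isBigO_refl (fun h : ℝ => h ^ 2) (𝓝 0)).smul hg).congr_right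
      (g₂ := fun h : ℝ => h ^ 8) fun h => by
        simp only [smul_eq_mul]
        ring).trans (isBigO_pow_of_le (by norm_num))
  refine IsBigO.congr_left (IsBigO.prod_left (f' := fun h => (integratorStep a h z).1 - q h)
    (g' := fun h => (integratorStep a h z).2 - v h) ?_ ?_) fun h => rfl
  · have h1 := hmul2 (((s₁.const_smul_left (54 / 120 : ℝ)).sub
      (s₂.const_smul_left (32 / 120 : ℝ))).add (s₃.const_smul_left (27 / 120 : ℝ)))
    -- The `h ^ 7` terms of the position, which need not cancel. In the velocity everything through
    -- `h ^ 6` cancels and no such remainder appears.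
    have h2 := isBigO_pow_of_continuousAt (f := fun _ : ℝ => (5 / 216 : ℝ) • f 5
      + (-(54 / 120) / 4860 + 32 / 120 / 640 - 27 / 120 / 405 : ℝ) • J 0 (f 3)
      - (27 / 120 / 1458 : ℝ) • J 0 (J 0 (f 1))
      + (-(54 / 120) / 3 / 972 + 32 / 120 / 2 / 192 - 27 / 120 * 2 / 3 / 243 : ℝ) • J 1 (f 2)
      + (-(54 / 120) / 9 / 162 + 32 / 120 / 4 / 48 - 27 / 120 * 4 / 9 / 81 : ℝ) • J 2 (f 1))
      continuousAt_const 7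
    refine ((h1.sub hx.position).add h2).congr_left fun h => ?_
    simp only [hstep, h0, Pi.smul_apply, map_smul, map_sub]
    module
  · have h1 := hmul ((((s₁.const_smul_left (162 / 240 : ℝ)).sub
      (s₂.const_smul_left (128 / 240 : ℝ))).add (s₃.const_smul_left (162 / 240 : ℝ))).add
      (s₄.const_smul_left (22 / 240 : ℝ)))
    refine (h1.sub hx.velocity).congr_left fun h => ?_
    simp only [hstep, h0, Pi.smul_apply, map_smul, map_add, map_sub]
    module

end Order

/-! ### Closed forms of the Verlet points and of both methods -/

section Identities

variable {E : Type*} [NormedAddCommGroup E] [NormedSpace ℝ E] (a : E → E) (z : E × E) (h : ℝ)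

theorem point_one_one : point a z 1 1 h = z.1 + h • z.2 + (h ^ 2 / 2) • a z.1 := by
  simp only [point, velocityVerlet, Function.iterate_one]
  push_cast
  module

theorem point_one_two : point a z 1 2 h = z.1 + (h / 2) • z.2 + (h ^ 2 / 8) • a z.1 := by
  simp only [point, velocityVerlet, Function.iterate_one]
  push_cast
  module

theorem point_one_three : point a z 1 3 h = z.1 + (h / 3) • z.2 + (h ^ 2 / 18) • a z.1 := by
  simp only [point, velocityVerlet, Function.iterate_one]
  push_cast
  module

theorem velocityVerlet_fst (k : ℝ) (w : E × E) :
    (velocityVerlet a k w).1 = w.1 + k • (w.2 + (k / 2) • a w.1) := rfl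

theorem velocityVerlet_snd (k : ℝ) (w : E × E) :
    (velocityVerlet a k w).2 = w.2 + (k / 2) • a w.1 + (k / 2) • a (velocityVerlet a k w).1 := rfl

/-- The velocity reached after `i + 1` steps, in terms of the forces at the positions reached. -/
theorem iterate_succ_snd (i k : ℕ) :
    ((velocityVerlet a (h / k))^[i + 1] z).2 = ((velocityVerlet a (h / k))^[i] z).2
      + (h / k / 2) • acc a z i k h + (h / k / 2) • acc a z (i + 1) k h := by
  rw [acc, acc, point, point, Function.iterate_succ_apply', velocityVerlet_snd]

theorem point_succ (i k : ℕ) :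
    point a z (i + 1) k h = point a z i k h
      + (h / k) • (((velocityVerlet a (h / k))^[i] z).2 + (h / k / 2) • acc a z i k h) := by
  rw [point, Function.iterate_succ_apply', velocityVerlet_fst]
  rfl

theorem acc_zero (k : ℕ) : acc a z 0 k h = a z.1 := rfl

theorem point_two_two : point a z 2 2 h
    = z.1 + h • z.2 + (h ^ 2 / 4) • (a z.1 + acc a z 1 2 h) := by
  rw [point_succ, iterate_succ_snd, acc_zero, point_one_two]
  simp only [Function.iterate_zero_apply]
  push_cast
  module

theorem point_two_three : point a z 2 3 h
    = z.1 + (2 / 3 * h) • z.2 + (h ^ 2 / 9) • (a z.1 + acc a z 1 3 h) := by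
  rw [point_succ, iterate_succ_snd, acc_zero, point_one_three]
  simp only [Function.iterate_zero_apply]
  push_cast
  module

theorem point_three_three : point a z 3 3 h = z.1 + h • z.2 + (h ^ 2 / 18) •
    ((3 : ℝ) • a z.1 + (4 : ℝ) • acc a z 1 3 h + (2 : ℝ) • acc a z 2 3 h) := by
  rw [point_succ, iterate_succ_snd, iterate_succ_snd, acc_zero, point_two_three]
  simp only [Function.iterate_zero_apply]
  push_cast
  module

/-- Writing the step sizes with natural number casts matches `point` and `iterate_succ_snd`. -/
theorem extrapolation123_eq : extrapolation123 a h z =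
    (1 / 24 : ℝ) • (velocityVerlet a (h / (1 : ℕ)))^[1] z
    - (16 / 15 : ℝ) • (velocityVerlet a (h / (2 : ℕ)))^[2] z
    + (81 / 40 : ℝ) • (velocityVerlet a (h / (3 : ℕ)))^[3] z := by
  simp [extrapolation123]

theorem extrapolation123_fst : (extrapolation123 a h z).1 =
    z.1 + h • z.2 + (h ^ 2 / 120) • ((11 : ℝ) • a z.1 + (54 : ℝ) • acc a z 1 3 h
      - (32 : ℝ) • acc a z 1 2 h + (27 : ℝ) • acc a z 2 3 h) := by
  have : (extrapolation123 a h z).1 = (1 / 24 : ℝ) • point a z 1 1 h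
    - (16 / 15 : ℝ) • point a z 2 2 h + (81 / 40 : ℝ) • point a z 3 3 h := by
    rw [extrapolation123_eq]
    rfl
  rw [this, point_one_one, point_two_two, point_three_three]
  module

theorem extrapolation123_snd : (extrapolation123 a h z).2 =
    z.2 + (h / 240) • ((22 : ℝ) • a z.1 + (162 : ℝ) • acc a z 1 3 h
      - (128 : ℝ) • acc a z 1 2 h + (162 : ℝ) • acc a z 2 3 h
      + (81 : ℝ) • acc a z 3 3 h - (64 : ℝ) • acc a z 2 2 h + (5 : ℝ) • acc a z 1 1 h) := by
  rw [extrapolation123_eq]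
  simp only [Prod.snd_add, Prod.snd_sub, Prod.smul_snd, iterate_succ_snd, acc_zero,
    Function.iterate_zero_apply, zero_add, Nat.reduceAdd]
  push_cast
  module

theorem delta₂_eq : delta₂ a z h = (h ^ 2 / 4) • (acc a z 1 2 h - a z.1) := by
  rw [delta₂, point_two_two, point_one_one]
  module

theorem delta₃_eq : delta₃ a z h = (h ^ 2 / 9) •
    ((2 : ℝ) • acc a z 1 3 h + acc a z 2 3 h - (3 : ℝ) • a z.1) := by
  rw [delta₃, point_three_three, point_one_one]
  module

theorem mergedPoint_eq : mergedPoint a z h = z.1 + h • z.2 + (h ^ 2 / 22) •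
    ((18 : ℝ) • acc a z 1 3 h - (16 : ℝ) • acc a z 1 2 h + (9 : ℝ) • acc a z 2 3 h) := by
  rw [mergedPoint, delta₂_eq, delta₃_eq, point_one_one]
  module

theorem integratorStep_fst : (integratorStep a h z).1 =
    z.1 + h • z.2 + (h ^ 2 / 120) • ((11 : ℝ) • a z.1 + (54 : ℝ) • acc a z 1 3 h
      - (32 : ℝ) • acc a z 1 2 h + (27 : ℝ) • acc a z 2 3 h) := by
  simp only [acc, point_two_three, point_one_two, point_one_three]
  rfl

theorem integratorStep_snd : (integratorStep a h z).2 =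
    z.2 + (h / 240) • ((22 : ℝ) • a z.1 + (162 : ℝ) • acc a z 1 3 h
      - (128 : ℝ) • acc a z 1 2 h + (162 : ℝ) • acc a z 2 3 h
      + (22 : ℝ) • a (mergedPoint a z h)) := by
  simp only [mergedPoint_eq, acc, point_two_three, point_one_two, point_one_three]
  rfl

/-- The stage equations are triangular, so they can be solved one after another; the unique solution
consists of the initial position, three Verlet points and the merged point. -/
theorem integratorTableau_realizes :
    integratorTableau.Realizes (E := E) integratorStep := by
  intro a h z
  have key : ∀ Q : Fin 5 → E, integratorTableau.IsStages a h z Q ↔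
      (Q 0 = z.1 ∧ Q 1 = z.1 + (h / 3) • z.2 + (h ^ 2 / 18) • a (Q 0) ∧
        Q 2 = z.1 + (h / 2) • z.2 + (h ^ 2 / 8) • a (Q 0) ∧
        Q 3 = z.1 + (2 / 3 * h) • z.2 + (h ^ 2 / 9) • (a (Q 0) + a (Q 1)) ∧
        Q 4 = z.1 + h • z.2 + (h ^ 2 / 22) •
          ((18 : ℝ) • a (Q 1) - (16 : ℝ) • a (Q 2) + (9 : ℝ) • a (Q 3))) := by
    intro Q
    simp only [Tableau.IsStages, Fin.forall_fin_succ, Fin.sum_univ_five, integratorTableau]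
    simp
    intro _
    refine and_congr (Eq.congr_right ?_) (and_congr (Eq.congr_right ?_)
      (and_congr (Eq.congr_right ?_) (Eq.congr_right ?_))) <;> module
  have key' : ∀ Q : Fin 5 → E, integratorTableau.IsStages a h z Q ↔
      Q = ![z.1, point a z 1 3 h, point a z 1 2 h, point a z 2 3 h, mergedPoint a z h] := by
    intro Q
    have hacc : ∀ i k, a (point a z i k h) = acc a z i k h := fun _ _ => rfl
    rw [key]
    constructor
    · rintro ⟨h0, h1, h2, h3, h4⟩
      rw [h0, ← point_one_three] at h1
      rw [h0, ← point_one_two] at h2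
      rw [h0, h1, hacc, ← point_two_three] at h3
      rw [h1, h2, h3, hacc, hacc, hacc, ← mergedPoint_eq] at h4
      ext i
      fin_cases i
      exacts [h0, h1, h2, h3, h4]
    · rintro rfl
      exact ⟨rfl, point_one_three .., point_one_two .., point_two_three .., mergedPoint_eq ..⟩
  refine ⟨⟨_, (key' _).2 rfl, fun Q hQ => (key' Q).1 hQ⟩, fun Q hQ => ?_⟩
  obtain rfl := (key' Q).1 hQ
  refine Prod.ext ?_ ?_
  · rw [integratorStep_fst]
    simp [Tableau.update, Fin.sum_univ_five, integratorTableau, acc]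
    module
  · rw [integratorStep_snd]
    simp [Tableau.update, Fin.sum_univ_five, integratorTableau, acc]
    module

end Identities

/-! ### Merging the final forces and the order of the extrapolation -/

section Merge

variable {E : Type*} [NormedAddCommGroup E] [NormedSpace ℝ E] {a : E → E} {z : E × E}

theorem tendsto_iterate_velocityVerlet (ha : ContinuousAt a z.1) (i k : ℕ) :
    Tendsto (fun h => (velocityVerlet a (h / k))^[i] z) (𝓝 0) (𝓝 z) := by
  induction i with
  | zero => exact tendsto_const_nhds
  | succ i ih =>
    -- This includes `k = 0`, where `h / 0 = 0`.
    have hk : Tendsto (fun h : ℝ => h / k) (𝓝 0) (𝓝 0) := by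
      simpa using (continuous_id.div_const (k : ℝ)).tendsto (0 : ℝ)
    have hk2 : Tendsto (fun h : ℝ => h / k / 2) (𝓝 0) (𝓝 0) := by
      simpa using hk.div_const 2
    have h1 := (continuous_fst.tendsto z).comp ih
    have h2 := (continuous_snd.tendsto z).comp ih
    have hm := h2.add (hk2.smul (ha.tendsto.comp h1))
    have hq := h1.add (hk.smul hm)
    simp only [zero_smul, add_zero] at hm hq
    have hv := hm.add (hk2.smul (ha.tendsto.comp hq))
    simp only [zero_smul, add_zero] at hv
    simp only [Function.iterate_succ_apply']
    exact hq.prodMk_nhds hv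

theorem tendsto_point (ha : ContinuousAt a z.1) (i k : ℕ) :
    Tendsto (point a z i k) (𝓝 0) (𝓝 z.1) :=
  (continuous_fst.tendsto z).comp (tendsto_iterate_velocityVerlet ha i k)

/-- Each step moves the position by `h / k` times a velocity that converges, hence is bounded. -/
theorem isBigO_point_sub (ha : ContinuousAt a z.1) (i k : ℕ) :
    (fun h => point a z i k h - z.1) =O[𝓝 0] fun h : ℝ => h := by
  induction i with
  | zero => simpa [point] using isBigO_zero _ _
  | succ i ih =>
    have hk : (fun h : ℝ => h / k) =O[𝓝 0] fun h : ℝ => h := by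
      simpa [div_eq_inv_mul] using (isBigO_refl (fun h : ℝ => h) (𝓝 0)).const_mul_left (k : ℝ)⁻¹
    have hk2 : Tendsto (fun h : ℝ => h / k / 2) (𝓝 0) (𝓝 0) := by
      simpa using ((continuous_id.div_const (k : ℝ)).div_const 2).tendsto (0 : ℝ)
    have hm := ((continuous_snd.tendsto z).comp (tendsto_iterate_velocityVerlet ha i k)).add
      (hk2.smul (ha.tendsto.comp (tendsto_point ha i k)))
    refine (ih.add ((hk.smul (hm.isBigO_one ℝ)).congr_right fun h => by simp)).congr_left
      fun h => ?_
    rw [point_succ, add_sub_right_comm]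
    rfl

theorem isBigO_acc_sub (ha : DifferentiableAt ℝ a z.1) (i k : ℕ) :
    (fun h => acc a z i k h - a z.1) =O[𝓝 0] fun h : ℝ => h :=
  (ha.isBigO_sub.comp_tendsto (tendsto_point ha.continuousAt i k)).trans
    (isBigO_point_sub ha.continuousAt i k)

theorem isBigO_sq_smul {E : Type*} [NormedAddCommGroup E] [NormedSpace ℝ E] {g : ℝ → E} (c : ℝ)
    (hg : g =O[𝓝 0] fun h : ℝ => h) :
    (fun h => (h ^ 2 / c) • g h) =O[𝓝 0] fun h : ℝ => h ^ 3 := by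
  refine (((isBigO_refl (fun h : ℝ => h ^ 2) (𝓝 0)).smul hg).const_smul_left c⁻¹).congr
    (fun h => ?_) fun h => ?_
  · rw [Pi.smul_apply, smul_smul, div_eq_inv_mul]
  · rw [smul_eq_mul, ← pow_succ]

theorem isBigO_delta₂ (ha : DifferentiableAt ℝ a z.1) :
    (fun h => delta₂ a z h) =O[𝓝 0] fun h : ℝ => h ^ 3 := by
  simp only [delta₂_eq]
  exact isBigO_sq_smul 4 (isBigO_acc_sub ha 1 2)

theorem isBigO_delta₃ (ha : DifferentiableAt ℝ a z.1) :
    (fun h => delta₃ a z h) =O[𝓝 0] fun h : ℝ => h ^ 3 := by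
  simp only [delta₃_eq]
  refine isBigO_sq_smul 9 ((((isBigO_acc_sub ha 1 3).const_smul_left (2 : ℝ)).add
    (isBigO_acc_sub ha 2 3)).congr_left fun h => ?_)
  rw [Pi.smul_apply]
  module

/-- The three final forces of the extrapolation merge into one. -/
theorem isBigO_merged_force (ha : ContDiffAt ℝ 2 a z.1) :
    (fun h => (81 : ℝ) • acc a z 3 3 h - (64 : ℝ) • acc a z 2 2 h + (5 : ℝ) • acc a z 1 1 h
      - (22 : ℝ) • a (mergedPoint a z h)) =O[𝓝 0] fun h : ℝ => h ^ 6 := by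
  have hd : DifferentiableAt ℝ a z.1 := ha.differentiableAt (by simp)
  have hP := tendsto_point hd.continuousAt 1 1
  have hm : (fun h => mergedPoint a z h - point a z 1 1 h) =O[𝓝 0] fun h : ℝ => h ^ 3 := by
    refine ((((isBigO_delta₃ hd).const_smul_left (81 : ℝ)).sub
      ((isBigO_delta₂ hd).const_smul_left (64 : ℝ))).const_smul_left (1 / 22 : ℝ)).congr_left
      fun h => ?_
    rw [mergedPoint, add_sub_cancel_left]
    rfl
  have hmt : Tendsto (mergedPoint a z) (𝓝 0) (𝓝 z.1) := by
    have h0 : Tendsto (fun h => mergedPoint a z h - point a z 1 1 h) (𝓝 0) (𝓝 0) :=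
      tendsto_of_isBigO_pow (n := 3) (by norm_num) (by simpa using hm)
    simpa using h0.add hP
  have key : ∀ {Q : ℝ → E}, Tendsto Q (𝓝 0) (𝓝 z.1) →
      (fun h => Q h - point a z 1 1 h) =O[𝓝 0] (fun h : ℝ => h ^ 3) →
      (fun h => a (Q h) - a (point a z 1 1 h)
        - fderiv ℝ a (point a z 1 1 h) (Q h - point a z 1 1 h)) =O[𝓝 0] fun h : ℝ => h ^ 6 := by
    intro Q hQ hQ3
    refine (isBigO_sub_sub_fderiv ha hP hQ).trans ?_
    simpa [← pow_mul] using hQ3.norm_left.pow 2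
  have k₃ := key (tendsto_point hd.continuousAt 3 3) (isBigO_delta₃ hd)
  have k₂ := key (tendsto_point hd.continuousAt 2 2) (isBigO_delta₂ hd)
  -- In this combination the derivative terms cancel by the choice of `mergedPoint`, and the forces
  -- at `q_{1/1}` add up to the coefficient `22 - 81 + 64 = 5`.
  refine (((k₃.const_smul_left (81 : ℝ)).sub (k₂.const_smul_left (64 : ℝ))).sub
    ((key hmt hm).const_smul_left (22 : ℝ))).congr_left fun h => ?_
  have hmerge : mergedPoint a z h - point a z 1 1 h = (1 / 22 : ℝ) •
      ((81 : ℝ) • (point a z 3 3 h - point a z 1 1 h)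
        - (64 : ℝ) • (point a z 2 2 h - point a z 1 1 h)) := by
    rw [mergedPoint, add_sub_cancel_left]
    rfl
  simp only [Pi.smul_apply, acc]
  rw [hmerge]
  simp only [map_smul, map_sub]
  module

/-- The extrapolation has order six because it differs from the integrator only by the merging
of the final forces. -/
theorem hasOrderAt_extrapolation123 (ha : ContDiffAt ℝ 6 a z.1) :
    HasOrderAt a (extrapolation123 a) 6 z := by
  intro q v hm
  have hi := hasOrderAt_integratorStep ha q v hm
  have hd : (fun h => extrapolation123 a h z - integratorStep a h z)
      =O[𝓝 0] fun h : ℝ => h ^ (6 + 1) := by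
    have h1 := ((isBigO_refl (fun h : ℝ => h) (𝓝 0)).smul
      (isBigO_merged_force (ha.of_le (by norm_num : (2 : WithTop ℕ∞) ≤ 6)))).const_smul_left
      (1 / 240 : ℝ)
    have h2 : (fun h => (extrapolation123 a h z - integratorStep a h z).2)
        =O[𝓝 0] fun h : ℝ => h ^ (6 + 1) := by
      refine h1.congr (fun h => ?_) fun h => ?_
      · rw [Prod.snd_sub, extrapolation123_snd, integratorStep_snd, Pi.smul_apply]
        module
      · rw [smul_eq_mul, pow_succ' h 6]
    refine ((isBigO_zero _ _).prod_left h2).congr_left (f₁ := fun h => ((0 : E),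
      (extrapolation123 a h z - integratorStep a h z).2)) fun h => Prod.ext ?_ rfl
    rw [Prod.fst_sub, extrapolation123_fst, integratorStep_fst, sub_self]
  refine (hd.add hi).congr_left fun h => ?_
  abel

end Merge

end RKN

/-! ### Assembly of the theorem -/

open RKN in
theorem mainTheorem5 {d : ℕ}
    (a : EuclideanSpace ℝ (Fin d) → EuclideanSpace ℝ (Fin d))
    (U : Set (EuclideanSpace ℝ (Fin d))) (hU : IsOpen U) (ha : ContDiffOn ℝ 6 a U)
    (q₀ v₀ : EuclideanSpace ℝ (Fin d)) (hq₀ : q₀ ∈ U) :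
    -- the force evaluation points of the velocity Verlet iterations
    (∀ h : ℝ,
      point a (q₀, v₀) 1 1 h = q₀ + h • v₀ + (h ^ 2 / 2) • a q₀ ∧
      point a (q₀, v₀) 1 2 h = q₀ + (h / 2) • v₀ + (h ^ 2 / 8) • a q₀ ∧
      point a (q₀, v₀) 2 2 h = q₀ + h • v₀ + (h ^ 2 / 4) • (a q₀ + acc a (q₀, v₀) 1 2 h) ∧
      point a (q₀, v₀) 1 3 h = q₀ + (h / 3) • v₀ + (h ^ 2 / 18) • a q₀ ∧
      point a (q₀, v₀) 2 3 h =
        q₀ + (2 / 3 * h) • v₀ + (h ^ 2 / 9) • (a q₀ + acc a (q₀, v₀) 1 3 h) ∧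
      point a (q₀, v₀) 3 3 h =
        q₀ + h • v₀ + (h ^ 2 / 18) • ((3 : ℝ) • a q₀ + (4 : ℝ) • acc a (q₀, v₀) 1 3 h
          + (2 : ℝ) • acc a (q₀, v₀) 2 3 h)) ∧
    -- the extrapolation of velocity Verlet
    (∀ h : ℝ,
      (extrapolation123 a h (q₀, v₀)).1 =
        q₀ + h • v₀ + (h ^ 2 / 120) • ((11 : ℝ) • a q₀ + (54 : ℝ) • acc a (q₀, v₀) 1 3 h
          - (32 : ℝ) • acc a (q₀, v₀) 1 2 h + (27 : ℝ) • acc a (q₀, v₀) 2 3 h) ∧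
      (extrapolation123 a h (q₀, v₀)).2 =
        v₀ + (h / 240) • ((22 : ℝ) • a q₀ + (162 : ℝ) • acc a (q₀, v₀) 1 3 h
          - (128 : ℝ) • acc a (q₀, v₀) 1 2 h + (162 : ℝ) • acc a (q₀, v₀) 2 3 h
          + (81 : ℝ) • acc a (q₀, v₀) 3 3 h - (64 : ℝ) • acc a (q₀, v₀) 2 2 h
          + (5 : ℝ) • acc a (q₀, v₀) 1 1 h)) ∧
    -- the differences of the final points
    (∀ h : ℝ,
      delta₂ a (q₀, v₀) h = (h ^ 2 / 4) • (acc a (q₀, v₀) 1 2 h - a q₀) ∧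
      delta₃ a (q₀, v₀) h = (h ^ 2 / 9) • ((2 : ℝ) • acc a (q₀, v₀) 1 3 h
        + acc a (q₀, v₀) 2 3 h - (3 : ℝ) • a q₀)) ∧
    (fun h : ℝ => delta₂ a (q₀, v₀) h) =O[𝓝 0] (fun h : ℝ => h ^ 3) ∧
    (fun h : ℝ => delta₃ a (q₀, v₀) h) =O[𝓝 0] (fun h : ℝ => h ^ 3) ∧
    -- the merged point and the merging of the three final forces
    (∀ h : ℝ,
      mergedPoint a (q₀, v₀) h =
        q₀ + h • v₀ + (h ^ 2 / 22) • ((18 : ℝ) • acc a (q₀, v₀) 1 3 h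
          - (16 : ℝ) • acc a (q₀, v₀) 1 2 h + (9 : ℝ) • acc a (q₀, v₀) 2 3 h)) ∧
    (fun h : ℝ => (81 : ℝ) • acc a (q₀, v₀) 3 3 h - (64 : ℝ) • acc a (q₀, v₀) 2 2 h
        + (5 : ℝ) • acc a (q₀, v₀) 1 1 h - (22 : ℝ) • a (mergedPoint a (q₀, v₀) h))
      =O[𝓝 0] (fun h : ℝ => h ^ 6) ∧
    -- the integrator
    (∀ h : ℝ,
      (integratorStep a h (q₀, v₀)).1 =
        q₀ + h • v₀ + (h ^ 2 / 120) • ((11 : ℝ) • a q₀ + (54 : ℝ) • acc a (q₀, v₀) 1 3 h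
          - (32 : ℝ) • acc a (q₀, v₀) 1 2 h + (27 : ℝ) • acc a (q₀, v₀) 2 3 h) ∧
      (integratorStep a h (q₀, v₀)).2 =
        v₀ + (h / 240) • ((22 : ℝ) • a q₀ + (162 : ℝ) • acc a (q₀, v₀) 1 3 h
          - (128 : ℝ) • acc a (q₀, v₀) 1 2 h + (162 : ℝ) • acc a (q₀, v₀) 2 3 h
          + (22 : ℝ) • a (mergedPoint a (q₀, v₀) h))) ∧
    -- it uses five force evaluations, is a Runge-Kutta-Nyström method, and has order six
    (∀ h : ℝ, (integrator h (q₀, v₀)).evals a = 5) ∧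
    integratorTableau.Realizes (E := EuclideanSpace ℝ (Fin d)) integratorStep ∧
    HasOrderAt a (extrapolation123 a) 6 (q₀, v₀) ∧
    HasOrderAt a (integratorStep a) 6 (q₀, v₀) := by 
  have hz : ContDiffAt ℝ 6 a q₀ := ha.contDiffAt (hU.mem_nhds hq₀)
  have hd : DifferentiableAt ℝ a q₀ := hz.differentiableAt (by simp)
  exact ⟨fun h => ⟨point_one_one .., point_one_two .., point_two_two .., point_one_three ..,
      point_two_three .., point_three_three ..⟩,
    fun h => ⟨extrapolation123_fst .., extrapolation123_snd ..⟩,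
    fun h => ⟨delta₂_eq .., delta₃_eq ..⟩,
    isBigO_delta₂ hd, isBigO_delta₃ hd, fun h => mergedPoint_eq ..,
    isBigO_merged_force (z := (q₀, v₀)) (hz.of_le (by norm_num)),
    fun h => ⟨integratorStep_fst .., integratorStep_snd ..⟩,
    -- The number of queries does not depend on the answers, so the count reduces to `5` by
    -- computation.
    fun h => rfl, integratorTableau_realizes, hasOrderAt_extrapolation123 hz,
    hasOrderAt_integratorStep hz⟩
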